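/- **Theorem 3.1.** Let $A$ and $B$ be unital complex Banach algebras with units $1_A$ and $1_B$, and let $M$ be a unital Banach $A$-$B$-bimodule, that is, a Banach space with commuting unital left and right actions of $A$ and $B$ satisfying $\|am\|\le\|a\|\,\|m\|$ and $\|mb\|\le\|m\|\,\|b\|$. Let $$\mathcal T=\begin{bmatrix}A&M\\0&B\end{bmatrix}=\left\{\begin{bmatrix}a&m\\0&b\end{bmatrix}: a\in A,\ m\in M,\ b\in B\right\}$$ be the triangular Banach algebra, with the usual matrix operations and the norm $\left\|\begin{bmatrix}a&m\\0&b\end{bmatrix}\right\|=\|a\|+\|m\|+\|b\|$. Identify $a\in A$ with $\begin{bmatrix}a&0\\0&0\end{bmatrix}$ and $b\in B$ with $\begin{bmatrix}0&0\\0&b\end{bmatrix}$. Let $X$ be a unital Banach $\mathcal T$-bimodule (a Banach space with commuting unital left and right actions of $\mathcal T$ that are bounded bilinear maps), and put $X_{AA}=1_AX1_A$ (a unital Banach $A$-bimodule), $X_{BB}=1_BX1_B$ (a unital Banach $B$-bimodule) and $X_{AB}=1_AX1_B$. For a Banach algebra $D$ and a Banach $D$-bimodule $Y$, let $C^n(D,Y)$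 be the Banach space of bounded $n$-linear maps $D\times\dots\times D\to Y$, with $C^0(D,Y)=Y$; let $\delta^n:C^n(D,Y)\to C^{n+1}(D,Y)$ be given by $$\delta^nf(d_1,\dots,d_{n+1})=d_1f(d_2,\dots,d_{n+1})+\sum_{k=1}^n(-1)^kf(d_1,\dots,d_kd_{k+1},\dots,d_{n+1})+(-1)^{n+1}f(d_1,\dots,d_n)d_{n+1},$$ and let $H^n(D,Y)=\operatorname{Ker}\delta^n/\operatorname{Im}\delta^{n-1}$ (with $\operatorname{Im}\delta^{-1}=0$), a seminormed space with the quotient seminorm. If $X_{AB}=0$, then for every $n\ge 0$ $$H^n(\mathcal T,X)\cong H^n(A,X_{AA})\oplus H^n(B,X_{BB}),$$ where $\cong$ denotes a linear isomorphism that is a homeomorphism for the seminorm topologies. -/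

import Mathlib

set_option linter.unusedSectionVars false

open MulOpposite

noncomputable section

/-! ### Triangular Banach algebras -/

/-- The set of formal matrices `[[a, m], [0, b]]` with `a ∈ A`, `m ∈ M`, `b ∈ B`. -/
@[ext]
structure TriangularAlgebra (A M B : Type*) where
  /-- the upper left entry -/
  a : A
  /-- the upper right entry -/
  m : M
  /-- the lower right entry -/
  b : B

namespace TriangularAlgebra

section AddGroup

variable {A M B : Type*} [AddCommGroup A] [AddCommGroup M] [AddCommGroup B]

instance : Zero (TriangularAlgebra A M B) := ⟨⟨0, 0, 0⟩⟩
instance : Add (TriangularAlgebra A M B) := ⟨fun s t => ⟨s.a + t.a, s.m + t.m, s.b + t.b⟩⟩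
instance : Neg (TriangularAlgebra A M B) := ⟨fun s => ⟨-s.a, -s.m, -s.b⟩⟩
instance : Sub (TriangularAlgebra A M B) := ⟨fun s t => ⟨s.a - t.a, s.m - t.m, s.b - t.b⟩⟩
instance [SMul ℂ A] [SMul ℂ M] [SMul ℂ B] : SMul ℂ (TriangularAlgebra A M B) :=
  ⟨fun c s => ⟨c • s.a, c • s.m, c • s.b⟩⟩

@[simp] theorem zero_a : (0 : TriangularAlgebra A M B).a = 0 := rfl
@[simp] theorem zero_m : (0 : TriangularAlgebra A M B).m = 0 := rfl
@[simp] theorem zero_b : (0 : TriangularAlgebra A M B).b = 0 := rfl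
@[simp] theorem add_a (s t : TriangularAlgebra A M B) : (s + t).a = s.a + t.a := rfl
@[simp] theorem add_m (s t : TriangularAlgebra A M B) : (s + t).m = s.m + t.m := rfl
@[simp] theorem add_b (s t : TriangularAlgebra A M B) : (s + t).b = s.b + t.b := rfl
@[simp] theorem neg_a (s : TriangularAlgebra A M B) : (-s).a = -s.a := rfl
@[simp] theorem neg_m (s : TriangularAlgebra A M B) : (-s).m = -s.m := rfl
@[simp] theorem neg_b (s : TriangularAlgebra A M B) : (-s).b = -s.b := rfl
@[simp] theorem sub_a (s t : TriangularAlgebra A M B) : (s - t).a = s.a - t.a := rfl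
@[simp] theorem sub_m (s t : TriangularAlgebra A M B) : (s - t).m = s.m - t.m := rfl
@[simp] theorem sub_b (s t : TriangularAlgebra A M B) : (s - t).b = s.b - t.b := rfl
@[simp] theorem smul_a [SMul ℂ A] [SMul ℂ M] [SMul ℂ B] (c : ℂ)
    (s : TriangularAlgebra A M B) : (c • s).a = c • s.a := rfl
@[simp] theorem smul_m [SMul ℂ A] [SMul ℂ M] [SMul ℂ B] (c : ℂ)
    (s : TriangularAlgebra A M B) : (c • s).m = c • s.m := rfl
@[simp] theorem smul_b [SMul ℂ A] [SMul ℂ M] [SMul ℂ B] (c : ℂ)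
    (s : TriangularAlgebra A M B) : (c • s).b = c • s.b := rfl

instance : AddCommGroup (TriangularAlgebra A M B) where
  add_assoc s t u := by ext <;> simp [add_assoc]
  zero_add s := by ext <;> simp
  add_zero s := by ext <;> simp
  add_comm s t := by ext <;> simp [add_comm]
  neg_add_cancel s := by ext <;> simp
  sub_eq_add_neg s t := by ext <;> simp [sub_eq_add_neg]
  nsmul := nsmulRec
  zsmul := zsmulRec

end AddGroup

section Banach

variable {A M B : Type*}
  [NormedRing A] [NormedAlgebra ℂ A] [NormedRing B] [NormedAlgebra ℂ B]
  [NormedAddCommGroup M] [NormedSpace ℂ M]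
  [Module A M] [IsScalarTower ℂ A M] [IsBoundedSMul A M]
  [Module Bᵐᵒᵖ M] [IsScalarTower ℂ Bᵐᵒᵖ M] [IsBoundedSMul Bᵐᵒᵖ M]
  [SMulCommClass A Bᵐᵒᵖ M]

instance : One (TriangularAlgebra A M B) := ⟨⟨1, 0, 1⟩⟩
/-- Matrix multiplication; the right action of `b` on `M` is written `op b • m`. -/
instance : Mul (TriangularAlgebra A M B) :=
  ⟨fun s t => ⟨s.a * t.a, s.a • t.m + op t.b • s.m, s.b * t.b⟩⟩

@[simp] theorem one_a : (1 : TriangularAlgebra A M B).a = 1 := rfl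
@[simp] theorem one_m : (1 : TriangularAlgebra A M B).m = 0 := rfl
@[simp] theorem one_b : (1 : TriangularAlgebra A M B).b = 1 := rfl
@[simp] theorem mul_a (s t : TriangularAlgebra A M B) : (s * t).a = s.a * t.a := rfl
@[simp] theorem mul_m (s t : TriangularAlgebra A M B) :
    (s * t).m = s.a • t.m + op t.b • s.m := rfl
@[simp] theorem mul_b (s t : TriangularAlgebra A M B) : (s * t).b = s.b * t.b := rfl

instance : Module ℂ (TriangularAlgebra A M B) where
  one_smul s := by ext <;> simp
  mul_smul c d s := by ext <;> simp [mul_smul]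
  smul_zero c := by ext <;> simp
  smul_add c s t := by ext <;> simp
  add_smul c d s := by ext <;> simp [add_smul]
  zero_smul s := by ext <;> simp

instance : Ring (TriangularAlgebra A M B) where
  __ := (inferInstance : AddCommGroup (TriangularAlgebra A M B))
  left_distrib s t u := by
    ext <;> simp [mul_add, add_smul]
    abel
  right_distrib s t u := by
    ext <;> simp [add_mul, add_smul]
    abel
  zero_mul s := by ext <;> simp
  mul_zero s := by ext <;> simp
  one_mul s := by ext <;> simp
  mul_one s := by ext <;> simp
  mul_assoc s t u := by
    ext <;> simp [mul_assoc, mul_smul, smul_comm, add_assoc]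

instance : Algebra ℂ (TriangularAlgebra A M B) :=
  Algebra.ofModule
    (fun c s t => by
      ext <;> simp [smul_add, smul_assoc]
      rw [smul_comm])
    (fun c s t => by
      ext <;> simp [smul_add, smul_assoc]
      rw [smul_comm])

/-- The norm `‖[[a, m], [0, b]]‖ = ‖a‖ + ‖m‖ + ‖b‖`. -/
instance : Norm (TriangularAlgebra A M B) := ⟨fun s => ‖s.a‖ + ‖s.m‖ + ‖s.b‖⟩

theorem norm_def (s : TriangularAlgebra A M B) : ‖s‖ = ‖s.a‖ + ‖s.m‖ + ‖s.b‖ := rfl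

theorem normCore : NormedSpace.Core ℂ (TriangularAlgebra A M B) where
  norm_nonneg s := by rw [norm_def]; positivity
  norm_smul c s := by simp only [norm_def, smul_a, smul_m, smul_b, norm_smul]; ring
  norm_triangle s t := by
    simp only [norm_def, add_a, add_m, add_b]
    linarith [norm_add_le s.a t.a, norm_add_le s.m t.m, norm_add_le s.b t.b]
  norm_eq_zero_iff s := by
    rw [norm_def]
    constructor
    · intro h
      have ha := norm_nonneg s.a
      have hm := norm_nonneg s.m
      have hb := norm_nonneg s.b
      ext
      · exact norm_eq_zero.1 (by linarith)
      · exact norm_eq_zero.1 (by linarith)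
      · exact norm_eq_zero.1 (by linarith)
    · rintro rfl
      simp

instance : NormedAddCommGroup (TriangularAlgebra A M B) :=
  NormedAddCommGroup.ofCore normCore

theorem norm_mul_le_mul (s t : TriangularAlgebra A M B) : ‖s * t‖ ≤ ‖s‖ * ‖t‖ := by
  simp only [norm_def, mul_a, mul_m, mul_b]
  have h1 := norm_mul_le s.a t.a
  have h2 := norm_mul_le s.b t.b
  have h3 := norm_add_le (s.a • t.m) (op t.b • s.m)
  have h4 := norm_smul_le s.a t.m
  have h5 := norm_smul_le (op t.b) s.m
  rw [norm_op] at h5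
  have ha := norm_nonneg s.a
  have hm := norm_nonneg s.m
  have hb := norm_nonneg s.b
  have ha' := norm_nonneg t.a
  have hm' := norm_nonneg t.m
  have hb' := norm_nonneg t.b
  nlinarith [mul_nonneg ha hb', mul_nonneg hm ha', mul_nonneg hm hm', mul_nonneg hb ha',
    mul_nonneg hb hm']

instance : NormedRing (TriangularAlgebra A M B) where
  __ := (inferInstance : NormedAddCommGroup (TriangularAlgebra A M B))
  __ := (inferInstance : Ring (TriangularAlgebra A M B))
  norm_mul_le := norm_mul_le_mul

instance : NormedAlgebra ℂ (TriangularAlgebra A M B) where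
  __ := (inferInstance : Algebra ℂ (TriangularAlgebra A M B))
  norm_smul_le c s := (normCore.norm_smul c s).le

instance [CompleteSpace A] [CompleteSpace M] [CompleteSpace B] :
    CompleteSpace (TriangularAlgebra A M B) := by
  let e : TriangularAlgebra A M B ≃ A × M × B :=
    { toFun := fun s => (s.a, s.m, s.b)
      invFun := fun p => ⟨p.1, p.2.1, p.2.2⟩
      left_inv := fun s => rfl
      right_inv := fun p => rfl }
  have hd : ∀ s t : TriangularAlgebra A M B,
      dist s t = dist s.a t.a + dist s.m t.m + dist s.b t.b := by
    intro s t
    simp only [dist_eq_norm]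
    rfl
  have h1 : LipschitzWith 1 e := LipschitzWith.of_dist_le_mul fun s t => by
    have ha := dist_nonneg (x := s.a) (y := t.a)
    have hm := dist_nonneg (x := s.m) (y := t.m)
    have hb := dist_nonneg (x := s.b) (y := t.b)
    simp only [Prod.dist_eq, hd, e, Equiv.coe_fn_mk, NNReal.coe_one, one_mul]
    refine max_le (by linarith) (max_le (by linarith) (by linarith))
  have h2 : LipschitzWith 3 e.symm := LipschitzWith.of_dist_le_mul fun p q => by
    have h := hd (e.symm p) (e.symm q)
    simp only [e, Equiv.coe_fn_symm_mk] at h ⊢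
    rw [h]
    have i1 : dist p.1 q.1 ≤ dist p q := le_max_left _ _
    have i2 : dist p.2 q.2 ≤ dist p q := le_max_right _ _
    have i3 : dist p.2.1 q.2.1 ≤ dist p.2 q.2 := le_max_left _ _
    have i4 : dist p.2.2 q.2.2 ≤ dist p.2 q.2 := le_max_right _ _
    push_cast
    linarith
  let u : TriangularAlgebra A M B ≃ᵤ A × M × B :=
    { e with
      uniformContinuous_toFun := h1.uniformContinuous
      uniformContinuous_invFun := h2.uniformContinuous }
  exact u.completeSpace_iff.2 inferInstance

end Banach

end TriangularAlgebra

/-! ### Corners of a bimodule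

For a bimodule `X` over `T`, the right action of `t` on `x` is written `op t • x`. -/

section Corner

variable {T : Type*} [NormedRing T] [NormedAlgebra ℂ T]

/-- The subspace `e X f = {e x f : x ∈ X}` of a `T`-bimodule `X`. -/
def peirceSpace (X : Type*) [NormedAddCommGroup X] [NormedSpace ℂ X]
    [Module T X] [IsScalarTower ℂ T X] [Module Tᵐᵒᵖ X] [IsScalarTower ℂ Tᵐᵒᵖ X]
    (e f : T) : Submodule ℂ X where
  carrier := {y | ∃ x : X, e • op f • x = y}
  zero_mem' := ⟨0, by simp⟩
  add_mem' := by
    rintro _ _ ⟨x, rfl⟩ ⟨y, rfl⟩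
    exact ⟨x + y, by simp⟩
  smul_mem' := by
    rintro c _ ⟨x, rfl⟩
    exact ⟨c • x, by rw [smul_comm (op f) c x, smul_comm e c]⟩

/-- A continuous homomorphism of algebras, not necessarily preserving the units. -/
structure CornerHom (A T : Type*) [NormedRing A] [NormedAlgebra ℂ A] [NormedRing T]
    [NormedAlgebra ℂ T] extends A →ₙₐ[ℂ] T where
  continuous_toFun : Continuous toFun

instance (A T : Type*) [NormedRing A] [NormedAlgebra ℂ A] [NormedRing T] [NormedAlgebra ℂ T] :
    CoeFun (CornerHom A T) (fun _ => A → T) := ⟨fun i => i.toNonUnitalAlgHom⟩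

namespace CornerHom

variable {A : Type*} [NormedRing A] [NormedAlgebra ℂ A] (i : CornerHom A T)

theorem map_mul (a a' : A) : i (a * a') = i a * i a' := _root_.map_mul i.toNonUnitalAlgHom a a'
theorem map_add (a a' : A) : i (a + a') = i a + i a' := _root_.map_add i.toNonUnitalAlgHom a a'
theorem map_zero : i 0 = 0 := _root_.map_zero i.toNonUnitalAlgHom
theorem map_smul (c : ℂ) (a : A) : i (c • a) = c • i a :=
  _root_.map_smul i.toNonUnitalAlgHom c a
theorem continuous : Continuous i := i.continuous_toFun
theorem mul_one (a : A) : i a * i 1 = i a := by rw [← map_mul, _root_.mul_one]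
theorem one_mul (a : A) : i 1 * i a = i a := by rw [← map_mul, _root_.one_mul]

end CornerHom

variable {A : Type*} [NormedRing A] [NormedAlgebra ℂ A]

/-- The corner `i(1) X i(1)` of the `T`-bimodule `X`, which is a unital bimodule over `A` with
the actions `a x = i(a) x` and `x a = x i(a)`. -/
def Corner (i : CornerHom A T) (X : Type*) [NormedAddCommGroup X] [NormedSpace ℂ X]
    [Module T X] [IsScalarTower ℂ T X] [Module Tᵐᵒᵖ X] [IsScalarTower ℂ Tᵐᵒᵖ X] : Type _ :=
  ↥(peirceSpace X (i 1) (i 1))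

namespace Corner

variable (i : CornerHom A T) {X : Type*} [NormedAddCommGroup X] [NormedSpace ℂ X]
    [Module T X] [IsScalarTower ℂ T X] [Module Tᵐᵒᵖ X] [IsScalarTower ℂ Tᵐᵒᵖ X]

instance : NormedAddCommGroup (Corner i X) :=
  inferInstanceAs (NormedAddCommGroup ↥(peirceSpace X (i 1) (i 1)))

instance : NormedSpace ℂ (Corner i X) :=
  inferInstanceAs (NormedSpace ℂ ↥(peirceSpace X (i 1) (i 1)))

variable {i}

@[ext]
theorem ext {x y : Corner i X} (h : x.1 = y.1) : x = y := Subtype.ext h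

theorem val_add (x y : Corner i X) : (x + y).1 = x.1 + y.1 := rfl
theorem val_zero : (0 : Corner i X).1 = 0 := rfl
theorem val_smul (c : ℂ) (x : Corner i X) : (c • x).1 = c • x.1 := rfl

theorem continuous_val : Continuous (fun x : Corner i X => x.1) := continuous_subtype_val

variable [SMulCommClass T Tᵐᵒᵖ X]

theorem one_smul_val (x : Corner i X) : i 1 • x.1 = x.1 := by
  obtain ⟨_, y, rfl⟩ := x
  simp only
  rw [← mul_smul, i.mul_one]

theorem op_one_smul_val (x : Corner i X) : op (i 1) • x.1 = x.1 := by
  obtain ⟨_, y, rfl⟩ := x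
  simp only
  rw [smul_comm (i 1) (op (i 1)) y, ← mul_smul, ← op_mul, i.mul_one]

instance : SMul A (Corner i X) :=
  ⟨fun a x => ⟨i a • x.1, i a • x.1, by
    rw [← smul_comm (i a) (op (i 1)), op_one_smul_val, ← mul_smul, i.one_mul]⟩⟩

instance : SMul Aᵐᵒᵖ (Corner i X) :=
  ⟨fun a x => ⟨op (i a.unop) • x.1, op (i a.unop) • x.1, by
    rw [← mul_smul (op (i 1)), ← op_mul, i.mul_one, smul_comm (i 1), one_smul_val]⟩⟩

theorem val_lsmul (a : A) (x : Corner i X) : (a • x).1 = i a • x.1 := rfl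
theorem val_rsmul (a : Aᵐᵒᵖ) (x : Corner i X) : (a • x).1 = op (i a.unop) • x.1 := rfl

instance : Module A (Corner i X) where
  one_smul x := by ext; rw [val_lsmul, one_smul_val]
  mul_smul a b x := by ext; simp only [val_lsmul, i.map_mul, mul_smul]
  smul_zero a := by ext; simp only [val_lsmul, val_zero, smul_zero]
  smul_add a x y := by ext; simp only [val_lsmul, val_add, smul_add]
  add_smul a b x := by ext; simp only [val_lsmul, val_add, i.map_add, add_smul]
  zero_smul x := by ext; simp only [val_lsmul, val_zero, i.map_zero, zero_smul]

instance : Module Aᵐᵒᵖ (Corner i X) where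
  one_smul x := by ext; rw [val_rsmul, unop_one, op_one_smul_val]
  mul_smul a b x := by ext; simp only [val_rsmul, unop_mul, i.map_mul, op_mul, mul_smul]
  smul_zero a := by ext; simp only [val_rsmul, val_zero, smul_zero]
  smul_add a x y := by ext; simp only [val_rsmul, val_add, smul_add]
  add_smul a b x := by ext; simp only [val_rsmul, val_add, unop_add, i.map_add, op_add, add_smul]
  zero_smul x := by ext; simp only [val_rsmul, val_zero, unop_zero, i.map_zero, op_zero, zero_smul]

instance : IsScalarTower ℂ A (Corner i X) where
  smul_assoc c a x := by ext; simp only [val_lsmul, val_smul, i.map_smul, smul_assoc]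

instance : IsScalarTower ℂ Aᵐᵒᵖ (Corner i X) where
  smul_assoc c a x := by
    ext; simp only [val_rsmul, val_smul, unop_smul, i.map_smul, op_smul, smul_assoc]

instance : SMulCommClass A Aᵐᵒᵖ (Corner i X) where
  smul_comm a b x := by ext; simp only [val_lsmul, val_rsmul, smul_comm]

instance [ContinuousSMul T X] : ContinuousSMul A (Corner i X) where
  continuous_smul := Continuous.subtype_mk
    ((i.continuous.comp continuous_fst).smul (continuous_val.comp continuous_snd)) _

instance [ContinuousSMul Tᵐᵒᵖ X] : ContinuousSMul Aᵐᵒᵖ (Corner i X) where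
  continuous_smul := Continuous.subtype_mk
    ((continuous_op.comp (i.continuous.comp (continuous_unop.comp continuous_fst))).smul
      (continuous_val.comp continuous_snd)) _

end Corner

end Corner

namespace TriangularAlgebra

variable (A M B : Type*)
  [NormedRing A] [NormedAlgebra ℂ A] [NormedRing B] [NormedAlgebra ℂ B]
  [NormedAddCommGroup M] [NormedSpace ℂ M]
  [Module A M] [IsScalarTower ℂ A M] [IsBoundedSMul A M]
  [Module Bᵐᵒᵖ M] [IsScalarTower ℂ Bᵐᵒᵖ M] [IsBoundedSMul Bᵐᵒᵖ M]
  [SMulCommClass A Bᵐᵒᵖ M]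

/-- The embedding `a ↦ [[a, 0], [0, 0]]`; in particular `inA 1` is `1_A` as an element of the
triangular algebra. -/
def inA : CornerHom A (TriangularAlgebra A M B) where
  toFun a := ⟨a, 0, 0⟩
  map_smul' c a := by ext <;> simp
  map_zero' := rfl
  map_add' a b := by ext <;> simp
  map_mul' a b := by ext <;> simp
  continuous_toFun := by
    refine (LipschitzWith.of_dist_le_mul (K := 1) fun s t => ?_).continuous
    simp [dist_eq_norm, norm_def]

/-- The embedding `b ↦ [[0, 0], [0, b]]`; in particular `inB 1` is `1_B` as an element of the
triangular algebra. -/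
def inB : CornerHom B (TriangularAlgebra A M B) where
  toFun b := ⟨0, 0, b⟩
  map_smul' c a := by ext <;> simp
  map_zero' := rfl
  map_add' a b := by ext <;> simp
  map_mul' a b := by ext <;> simp
  continuous_toFun := by
    refine (LipschitzWith.of_dist_le_mul (K := 1) fun s t => ?_).continuous
    simp [dist_eq_norm, norm_def]

end TriangularAlgebra

/-! ### Hochschild cohomology with bounded cochains -/

namespace Hochschild

section Defs

variable (A X : Type*) [NormedRing A] [NormedAlgebra ℂ A]
  [NormedAddCommGroup X] [NormedSpace ℂ X]

/-- The space `C^n(A, X)` of bounded `n`-linear mappings; `C^0(A, X)` is `X`, up to the canonical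
identification. -/
abbrev Cochain (n : ℕ) : Type _ := ContinuousMultilinearMap ℂ (fun _ : Fin n => A) X

variable {A X} {n : ℕ}

/-- Multiplying two neighbouring arguments is affected linearly by a change of one argument. -/
theorem contractNth_update (k : Fin n) (v : Fin (n + 1) → A) (i : Fin (n + 1)) :
    ∃ (j : Fin n) (L : A →ₗ[ℂ] A), ∀ x : A,
      k.castSucc.contractNth (· * ·) (Function.update v i x) =
        Function.update (k.castSucc.contractNth (· * ·) v) j (L x) := by
  rcases lt_trichotomy (i : ℕ) (k : ℕ) with h | h | h
  · refine ⟨⟨i, by omega⟩, LinearMap.id, fun x => ?_⟩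
    ext j
    simp only [Fin.contractNth, Function.update_apply, Fin.ext_iff, Fin.val_castSucc,
      Fin.val_succ, LinearMap.id_apply]
    grind
  · refine ⟨k, LinearMap.mulRight ℂ (v k.succ), fun x => ?_⟩
    ext j
    rcases lt_trichotomy (j : ℕ) (k : ℕ) with h' | h' | h'
    · rw [Fin.contractNth_apply_of_lt _ _ _ _ (by simpa using h'),
        Function.update_of_ne (by simp [Fin.ext_iff]; omega),
        Function.update_of_ne (by simp [Fin.ext_iff]; omega),
        Fin.contractNth_apply_of_lt _ _ _ _ (by simpa using h')]
    · obtain rfl : j = k := Fin.ext h'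
      obtain rfl : i = j.castSucc := Fin.ext (by simpa using h)
      rw [Fin.contractNth_apply_of_eq _ _ _ _ (by simp)]
      simp [Function.update_of_ne (Fin.castSucc_lt_succ (i := j)).ne']
    · rw [Fin.contractNth_apply_of_gt _ _ _ _ (by simpa using h'),
        Function.update_of_ne (by simp [Fin.ext_iff]; omega),
        Function.update_of_ne (by simp [Fin.ext_iff]; omega),
        Fin.contractNth_apply_of_gt _ _ _ _ (by simpa using h')]
  · by_cases h2 : (i : ℕ) = k + 1
    · refine ⟨k, LinearMap.mulLeft ℂ (v k.castSucc), fun x => ?_⟩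
      ext j
      rcases lt_trichotomy (j : ℕ) (k : ℕ) with h' | h' | h'
      · rw [Fin.contractNth_apply_of_lt _ _ _ _ (by simpa using h'),
          Function.update_of_ne (by simp [Fin.ext_iff]; omega),
          Function.update_of_ne (by simp [Fin.ext_iff]; omega),
          Fin.contractNth_apply_of_lt _ _ _ _ (by simpa using h')]
      · obtain rfl : j = k := Fin.ext h'
        obtain rfl : i = j.succ := Fin.ext (by simpa using h2)
        rw [Fin.contractNth_apply_of_eq _ _ _ _ (by simp)]
        simp [Function.update_of_ne (Fin.castSucc_lt_succ (i := j)).ne]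
      · rw [Fin.contractNth_apply_of_gt _ _ _ _ (by simpa using h'),
          Function.update_of_ne (by simp [Fin.ext_iff]; omega),
          Function.update_of_ne (by simp [Fin.ext_iff]; omega),
          Fin.contractNth_apply_of_gt _ _ _ _ (by simpa using h')]
    · refine ⟨⟨i - 1, by omega⟩, LinearMap.id, fun x => ?_⟩
      ext j
      simp only [Fin.contractNth, Function.update_apply, Fin.ext_iff, Fin.val_castSucc,
        Fin.val_succ, LinearMap.id_apply]
      grind

theorem continuous_contractNth (k : Fin n) :
    Continuous fun v : Fin (n + 1) → A => k.castSucc.contractNth (· * ·) v := by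
  refine continuous_pi fun j => ?_
  unfold Fin.contractNth
  split_ifs <;> fun_prop

/-- The cochain `(a₁, …, aₙ₊₁) ↦ f(a₁, …, aₖ aₖ₊₁, …, aₙ₊₁)` (with `k` counted from `0`). -/
def inner (k : Fin n) (f : Cochain A X n) : Cochain A X (n + 1) where
  toMultilinearMap := MultilinearMap.mk' (fun v => f (k.castSucc.contractNth (· * ·) v))
    (fun v i x y => by
      obtain ⟨j, L, h⟩ := contractNth_update k v i
      simp only [h, map_add, f.map_update_add])
    (fun v i c x => by
      obtain ⟨j, L, h⟩ := contractNth_update k v i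
      simp only [h, map_smul, f.map_update_smul])
  cont := f.cont.comp (continuous_contractNth k)

variable [Module A X] [IsScalarTower ℂ A X] [ContinuousSMul A X]
  [Module Aᵐᵒᵖ X] [IsScalarTower ℂ Aᵐᵒᵖ X] [ContinuousSMul Aᵐᵒᵖ X]

/-- The cochain `(a₁, …, aₙ₊₁) ↦ a₁ f(a₂, …, aₙ₊₁)`. -/
def left (f : Cochain A X n) : Cochain A X (n + 1) where
  toMultilinearMap := MultilinearMap.mk' (fun v => v 0 • f (Fin.tail v))
    (fun v i x y => by
      refine Fin.cases ?_ (fun j => ?_) i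
      · simp [add_smul]
      · simp [Fin.tail_update_succ, (Fin.succ_ne_zero j).symm])
    (fun v i c x => by
      refine Fin.cases ?_ (fun j => ?_) i
      · simp
      · simp [Fin.tail_update_succ, (Fin.succ_ne_zero j).symm, smul_comm c])
  cont := (continuous_apply 0).smul
    (f.cont.comp (continuous_pi fun j => continuous_apply j.succ))

/-- The cochain `(a₁, …, aₙ₊₁) ↦ f(a₁, …, aₙ) aₙ₊₁`. -/
def right (f : Cochain A X n) : Cochain A X (n + 1) where
  toMultilinearMap := MultilinearMap.mk' (fun v => op (v (Fin.last n)) • f (Fin.init v))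
    (fun v i x y => by
      refine Fin.lastCases ?_ (fun j => ?_) i
      · simp [add_smul]
      · simp [Fin.init_update_castSucc, (Fin.castSucc_lt_last j).ne'])
    (fun v i c x => by
      refine Fin.lastCases ?_ (fun j => ?_) i
      · simp
      · simp [Fin.init_update_castSucc, (Fin.castSucc_lt_last j).ne', smul_comm c])
  cont := (continuous_op.comp (continuous_apply (Fin.last n))).smul
    (f.cont.comp (continuous_pi fun j => continuous_apply j.castSucc))

theorem inner_apply (k : Fin n) (f : Cochain A X n) (v : Fin (n + 1) → A) :
    inner k f v = f (k.castSucc.contractNth (· * ·) v) := rfl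
theorem left_apply (f : Cochain A X n) (v : Fin (n + 1) → A) :
    left f v = v 0 • f (Fin.tail v) := rfl
theorem right_apply (f : Cochain A X n) (v : Fin (n + 1) → A) :
    right f v = op (v (Fin.last n)) • f (Fin.init v) := rfl

variable (A X n)

/-- The Hochschild coboundary operator `δⁿ : C^n(A, X) → C^{n+1}(A, X)`,
`δⁿ f (a₁, …, aₙ₊₁) = a₁ f(a₂, …, aₙ₊₁) + ∑_{k=1}^n (-1)^k f(a₁, …, aₖ aₖ₊₁, …, aₙ₊₁)
  + (-1)^{n+1} f(a₁, …, aₙ) aₙ₊₁`. -/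
def delta : Cochain A X n →ₗ[ℂ] Cochain A X (n + 1) where
  toFun f := left f + ∑ k : Fin n, (-1 : ℂ) ^ ((k : ℕ) + 1) • inner k f
    + (-1 : ℂ) ^ (n + 1) • right f
  map_add' f g := by
    ext v
    simp only [add_apply, sum_apply,
      smul_apply, left_apply, right_apply, inner_apply, smul_add,
      Finset.sum_add_distrib]
    abel
  map_smul' c f := by
    ext v
    simp only [add_apply, sum_apply,
      smul_apply, left_apply, right_apply, inner_apply, smul_add,
      Finset.smul_sum, RingHom.id_apply, smul_comm _ c]

/-- The space `Z^n(A, X) = Ker δⁿ` of cocycles. -/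
def cocycles : Submodule ℂ (Cochain A X n) := LinearMap.ker (delta A X n)

/-- The space `B^n(A, X) = Im δⁿ⁻¹` of coboundaries, with `B^0(A, X) = 0`. -/
def coboundaries : (n : ℕ) → Submodule ℂ (Cochain A X n)
  | 0 => ⊥
  | n + 1 => LinearMap.range (delta A X n)

/-- The cohomology group `H^n(A, X) = Z^n(A, X) / B^n(A, X)`, with its quotient seminorm. -/
abbrev Cohomology : Type _ := ↥(cocycles A X n) ⧸ (coboundaries A X n).submoduleOf (cocycles A X n)

end Defs

end Hochschild

end

noncomputable section

/-! ### The bimodule of bounded linear maps on an algebra -/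

section Bound

/-! Let `e` and `f` be the images of the two units in the triangular algebra `T`: orthogonal
idempotents with sum `1` and `f T e = 0`. Averaging over the separability element `e ⊗ e + f ⊗ f` of
their span gives a homotopy `h` on bounded cochains with `δh + hδ = 1 - P`
(`delta_homotopy_add_homotopy_delta`), where `P` = `relativize` inserts `e` and `f` between all
arguments. So a cocycle `φ` is cohomologous to `Pφ`.

Of the four corners of `Pφ`, the corner `f · e` vanishes because `f T e = 0`, the corner `e · f`
because `e X f = 0`, and the diagonal ones are `e φ(e · e, …, e · e) e` and `f φ(f · f, …, f · f) f`
(`corner_relativize`, `relativize_apply`). But this block diagonal cochain is what remains of `φ`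
after restricting it to `A` and `B` and inflating the results back along `t ↦ t.a` and `t ↦ t.b`.
Restriction followed by inflation is therefore the identity on cohomology, and the opposite
composite is the identity already on cocycles. Both maps are induced by bounded maps of cochains,
hence continuous for the quotient seminorms.

The homotopy is handled without explicit sums. A cochain of degree `n + 1` in `Y` is a cochain of
degree `n` in the bimodule of bounded maps `T → Y`, and `delta_cons` compares the two coboundaries.
Definitions and proofs are then recursions on `n` with the bimodule left free. -/

theorem norm_half_div_smul_lt {E : Type*} [NormedAddCommGroup E] [NormedSpace ℂ E] {d : ℝ}
    (hd : 0 < d) {x : E} (hx : x ≠ 0) : ‖((d / 2 / ‖x‖ : ℝ) : ℂ) • x‖ < d := by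
  have : ‖x‖ ≠ 0 := norm_ne_zero_iff.2 hx
  rw [norm_smul, Complex.norm_real, Real.norm_of_nonneg (by positivity), div_mul_cancel₀ _ this]
  linarith

/-- A jointly continuous bilinear map is bounded. The actions on `X` are only assumed continuous,
while the operator norm on maps `T → Y` requires an explicit bound. -/
theorem exists_norm_smul_le_of_continuousSMul (S Y : Type*) [NormedRing S] [NormedAlgebra ℂ S]
    [NormedAddCommGroup Y] [NormedSpace ℂ Y] [Module S Y] [IsScalarTower ℂ S Y]
    [ContinuousSMul S Y] : ∃ C : ℝ, ∀ (s : S) (y : Y), ‖s • y‖ ≤ C * ‖s‖ * ‖y‖ := by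
  have hc : ContinuousAt (fun p : S × Y => p.1 • p.2) (0, 0) := continuous_smul.continuousAt
  obtain ⟨d, hd, h⟩ := Metric.continuousAt_iff.1 hc 1 one_pos
  have hd0 : d ≠ 0 := hd.ne'
  have key : ∀ (s : S) (y : Y), ‖s‖ < d → ‖y‖ < d → ‖s • y‖ < 1 := fun s y hs hy => by
    simpa using h (x := (s, y)) (by simp [Prod.dist_eq, hs, hy])
  refine ⟨4 / d ^ 2, fun s y => ?_⟩
  rcases eq_or_ne s 0 with rfl | hs
  · simp
  rcases eq_or_ne y 0 with rfl | hy
  · simp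
  -- Both vectors are rescaled to norm `d / 2`; undoing the two scalings produces the constant `4 /
  -- d ^ 2`.
  have h1 := key _ _ (norm_half_div_smul_lt hd hs) (norm_half_div_smul_lt hd hy)
  have hs' : 0 < ‖s‖ := norm_pos_iff.2 hs
  have hy' : 0 < ‖y‖ := norm_pos_iff.2 hy
  rw [smul_assoc, smul_comm s, norm_smul, norm_smul, Complex.norm_real, Complex.norm_real,
    Real.norm_of_nonneg (by positivity), Real.norm_of_nonneg (by positivity)] at h1
  have h2 : d / 2 / ‖s‖ * (d / 2 / ‖y‖ * ‖s • y‖) * (4 / d ^ 2 * ‖s‖ * ‖y‖) = ‖s • y‖ := by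
    field_simp
    ring
  rw [← h2]
  exact mul_le_of_le_one_left (by positivity) h1.le

end Bound

/-- The bounded linear maps `T → Y`, as a `T`-bimodule with `(s L)(t) = L(ts)` and
`(L s)(t) = L(t) s`. -/
def LinBimodule.{u, v} (T : Type u) (Y : Type (max u v)) [NormedRing T] [NormedAlgebra ℂ T]
    [NormedAddCommGroup Y] [NormedSpace ℂ Y] : Type (max u v) := T →L[ℂ] Y

namespace LinBimodule

universe u v

variable {T : Type u} {Y : Type (max u v)} [NormedRing T] [NormedAlgebra ℂ T]
    [NormedAddCommGroup Y] [NormedSpace ℂ Y]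

instance : NormedAddCommGroup (LinBimodule.{u, v} T Y) :=
  inferInstanceAs (NormedAddCommGroup (T →L[ℂ] Y))
instance : NormedSpace ℂ (LinBimodule.{u, v} T Y) :=
  inferInstanceAs (NormedSpace ℂ (T →L[ℂ] Y))
instance : CoeFun (LinBimodule.{u, v} T Y) (fun _ => T → Y) :=
  ⟨fun L => DFunLike.coe (F := T →L[ℂ] Y) L⟩

@[ext]
theorem ext {L L' : LinBimodule.{u, v} T Y} (h : ∀ t, L t = L' t) : L = L' :=
  ContinuousLinearMap.ext h

@[simp] theorem add_apply (L L' : LinBimodule.{u, v} T Y) (t : T) : (L + L') t = L t + L' t := rfl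
@[simp] theorem sub_apply (L L' : LinBimodule.{u, v} T Y) (t : T) : (L - L') t = L t - L' t := rfl
@[simp] theorem zero_apply (t : T) : (0 : LinBimodule.{u, v} T Y) t = 0 := rfl
@[simp] theorem smul_apply (c : ℂ) (L : LinBimodule.{u, v} T Y) (t : T) : (c • L) t = c • L t := rfl
@[simp] theorem map_add (L : LinBimodule.{u, v} T Y) (s t : T) : L (s + t) = L s + L t :=
  ContinuousLinearMap.map_add (show T →L[ℂ] Y from L) s t
@[simp] theorem map_smul (L : LinBimodule.{u, v} T Y) (c : ℂ) (t : T) : L (c • t) = c • L t :=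
  ContinuousLinearMap.map_smul (show T →L[ℂ] Y from L) c t
@[simp] theorem map_zero (L : LinBimodule.{u, v} T Y) : L 0 = 0 :=
  ContinuousLinearMap.map_zero (show T →L[ℂ] Y from L)

/-- Evaluation at an element of the algebra. -/
def eval (t : T) : LinBimodule.{u, v} T Y →L[ℂ] Y := ContinuousLinearMap.apply ℂ Y t

@[simp] theorem eval_apply (t : T) (L : LinBimodule.{u, v} T Y) : eval t L = L t := rfl

instance : SMul T (LinBimodule.{u, v} T Y) :=
  ⟨fun s L => (show T →L[ℂ] Y from L).comp ((ContinuousLinearMap.mul ℂ T).flip s)⟩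

@[simp] theorem lsmul_apply (s : T) (L : LinBimodule.{u, v} T Y) (t : T) : (s • L) t = L (t * s) :=
  rfl

instance : Module T (LinBimodule.{u, v} T Y) where
  one_smul L := by ext; simp
  mul_smul a b L := by ext; simp [mul_assoc]
  smul_zero a := by ext; simp
  smul_add a x y := by ext; simp
  add_smul a b x := by ext; simp [mul_add]
  zero_smul x := by ext; simp

instance : IsScalarTower ℂ T (LinBimodule.{u, v} T Y) where
  smul_assoc c a x := by ext; simp

instance : ContinuousSMul T (LinBimodule.{u, v} T Y) where
  continuous_smul := by
    have h : Continuous fun p : T × (T →L[ℂ] Y) =>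
        p.2.comp ((ContinuousLinearMap.mul ℂ T).flip p.1) := by fun_prop
    exact h

variable [Module Tᵐᵒᵖ Y] [IsScalarTower ℂ Tᵐᵒᵖ Y] [ContinuousSMul Tᵐᵒᵖ Y]

instance : SMul Tᵐᵒᵖ (LinBimodule.{u, v} T Y) :=
  ⟨fun s L => (s • (show T →L[ℂ] Y from L) : T →L[ℂ] Y)⟩

@[simp] theorem rsmul_apply (s : Tᵐᵒᵖ) (L : LinBimodule.{u, v} T Y) (t : T) :
    (s • L) t = s • L t := rfl

instance : Module Tᵐᵒᵖ (LinBimodule.{u, v} T Y) where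
  one_smul L := by ext; simp
  mul_smul a b L := by ext; simp [mul_smul]
  smul_zero a := by ext; simp
  smul_add a x y := by ext; simp
  add_smul a b x := by ext; simp [add_smul]
  zero_smul x := by ext; simp

instance : IsScalarTower ℂ Tᵐᵒᵖ (LinBimodule.{u, v} T Y) where
  smul_assoc c a x := by ext; simp

instance : SMulCommClass T Tᵐᵒᵖ (LinBimodule.{u, v} T Y) where
  smul_comm a b x := by ext; simp

instance : ContinuousSMul Tᵐᵒᵖ (LinBimodule.{u, v} T Y) where
  continuous_smul := by
    -- The bound makes `s ↦ (y ↦ y s)` continuous into the operator norm, so that composing with it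
    -- is jointly continuous.
    obtain ⟨C, hC⟩ := exists_norm_smul_le_of_continuousSMul Tᵐᵒᵖ Y
    let F : Tᵐᵒᵖ →L[ℂ] Y →L[ℂ] Y := LinearMap.mkContinuous₂
      (LinearMap.mk₂ ℂ (fun (s : Tᵐᵒᵖ) (y : Y) => s • y) (fun _ _ _ => add_smul _ _ _)
        (fun _ _ _ => smul_assoc _ _ _) (fun _ _ _ => smul_add _ _ _)
        (fun _ _ _ => smul_comm _ _ _)) C hC
    have h : Continuous fun p : Tᵐᵒᵖ × (T →L[ℂ] Y) => (F p.1).comp p.2 := by fun_prop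
    exact h

end LinBimodule

/-! ### Change of algebra and bimodule; currying of cochains -/

namespace Hochschild

section Pull

variable {A D X Y : Type*} [NormedRing A] [NormedAlgebra ℂ A] [NormedRing D] [NormedAlgebra ℂ D]
  [NormedAddCommGroup X] [NormedSpace ℂ X] [NormedAddCommGroup Y] [NormedSpace ℂ Y]

/-- The map `φ ↦ c ∘ φ ∘ (i × ⋯ × i)` on cochains. -/
def pull (i : D →L[ℂ] A) (c : X →L[ℂ] Y) (n : ℕ) : Cochain A X n →L[ℂ] Cochain D Y n :=
  (ContinuousLinearMap.compContinuousMultilinearMapL ℂ (fun _ : Fin n => D) X Y c).comp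
    (ContinuousMultilinearMap.compContinuousLinearMapL (fun _ : Fin n => i))

theorem pull_apply (i : D →L[ℂ] A) (c : X →L[ℂ] Y) {n : ℕ} (φ : Cochain A X n) (v : Fin n → D) :
    pull i c n φ v = c (φ fun j => i (v j)) := rfl

variable [Module A X] [IsScalarTower ℂ A X] [ContinuousSMul A X]
  [Module Aᵐᵒᵖ X] [IsScalarTower ℂ Aᵐᵒᵖ X] [ContinuousSMul Aᵐᵒᵖ X]
  [Module D Y] [IsScalarTower ℂ D Y] [ContinuousSMul D Y]
  [Module Dᵐᵒᵖ Y] [IsScalarTower ℂ Dᵐᵒᵖ Y] [ContinuousSMul Dᵐᵒᵖ Y]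

theorem delta_apply {n : ℕ} (φ : Cochain A X n) (v : Fin (n + 1) → A) :
    delta A X n φ v = v 0 • φ (Fin.tail v)
      + ∑ k : Fin n, (-1 : ℂ) ^ ((k : ℕ) + 1) • φ (k.castSucc.contractNth (· * ·) v)
      + (-1 : ℂ) ^ (n + 1) • op (v (Fin.last n)) • φ (Fin.init v) := by
  simp [delta, left_apply, right_apply, inner_apply]

/-- All terms of the coboundary except the first commute with `pull` once `i` is multiplicative and
`c` is right linear. Left linearity of `c` is deliberately not required: the lemma is needed for
`contraction`, which lacks it. -/
theorem delta_pull_sub (i : D →L[ℂ] A) (c : X →L[ℂ] Y) (hi : ∀ s t, i (s * t) = i s * i t)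
    (hr : ∀ (d : D) (x : X), c (op (i d) • x) = op d • c x) {n : ℕ}
    (φ : Cochain A X n) (v : Fin (n + 1) → D) :
    delta D Y n (pull i c n φ) v - v 0 • c (φ fun j => i (v j.succ)) =
      pull i c (n + 1) (delta A X n φ) v - c (i (v 0) • φ fun j => i (v j.succ)) := by
  have h : ∀ k : Fin n, (fun j => i (k.castSucc.contractNth (· * ·) v j)) =
      k.castSucc.contractNth (· * ·) fun j => i (v j) := fun k => by
    funext j
    unfold Fin.contractNth
    split_ifs <;> simp [hi]
  have ht : (Fin.tail fun j => i (v j)) = fun j => i (v j.succ) := rfl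
  have hn : (Fin.init fun j => i (v j)) = fun j => i (v j.castSucc) := rfl
  have ht' : (fun j => i (Fin.tail v j)) = fun j => i (v j.succ) := rfl
  have hn' : (fun j => i (Fin.init v j)) = fun j => i (v j.castSucc) := rfl
  simp only [pull_apply, delta_apply, map_add, map_sum, map_smul, hr, h, ht, hn, ht', hn']
  abel

theorem delta_pull (i : D →L[ℂ] A) (c : X →L[ℂ] Y) (hi : ∀ s t, i (s * t) = i s * i t)
    (hl : ∀ (d : D) (x : X), c (i d • x) = d • c x)
    (hr : ∀ (d : D) (x : X), c (op (i d) • x) = op d • c x) {n : ℕ} (φ : Cochain A X n) :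
    delta D Y n (pull i c n φ) = pull i c (n + 1) (delta A X n φ) := by
  ext v
  have h := delta_pull_sub i c hi hr φ v
  rw [hl] at h
  exact sub_left_injective h

end Pull

section Curry

universe u v

variable {T : Type u} {Y : Type (max u v)} [NormedRing T] [NormedAlgebra ℂ T]
    [NormedAddCommGroup Y] [NormedSpace ℂ Y]

/-- `φ ↦ ((t₁, …, tₙ) ↦ (t ↦ φ(t, t₁, …, tₙ)))`. -/
def curry {n : ℕ} (φ : Cochain T Y (n + 1)) : Cochain T (LinBimodule.{u, v} T Y) n :=
  (ContinuousMultilinearMap.curryLeft φ).flipMultilinear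

/-- The inverse of `curry`. -/
def uncurry {n : ℕ} (φ : Cochain T (LinBimodule.{u, v} T Y) n) : Cochain T Y (n + 1) :=
  ContinuousLinearMap.uncurryLeft
    (ContinuousMultilinearMap.flipLinear (G := T) (G' := Y) φ)

theorem curry_apply {n : ℕ} (φ : Cochain T Y (n + 1)) (r : Fin n → T) (t : T) :
    curry φ r t = φ (Fin.cons t r) := rfl

theorem curry_uncurry {n : ℕ} (φ : Cochain T (LinBimodule.{u, v} T Y) n) :
    curry (uncurry φ) = φ := rfl

theorem ext_cons {Z : Type*} [NormedAddCommGroup Z] [NormedSpace ℂ Z] {n : ℕ}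
    {φ ψ : Cochain T Z (n + 1)}
    (h : ∀ (t : T) (r : Fin n → T), φ (Fin.cons t r) = ψ (Fin.cons t r)) : φ = ψ := by
  ext v
  rw [← Fin.cons_self_tail v]
  exact h _ _

variable [Module T Y] [IsScalarTower ℂ T Y] [ContinuousSMul T Y]
  [Module Tᵐᵒᵖ Y] [IsScalarTower ℂ Tᵐᵒᵖ Y] [ContinuousSMul Tᵐᵒᵖ Y]

theorem contractNth_zero_cons {n : ℕ} (t : T) (r : Fin (n + 1) → T) :
    (0 : Fin (n + 2)).contractNth (· * ·) (Fin.cons t r : Fin (n + 2) → T) =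
      Fin.cons (t * r 0) (Fin.tail r) := by
  funext j
  refine Fin.cases ?_ (fun j => ?_) j
  · simp [Fin.contractNth]
  · simp [Fin.contractNth, Fin.tail]

theorem contractNth_succ_cons {n : ℕ} (k : Fin (n + 1)) (t : T) (r : Fin (n + 1) → T) :
    k.succ.contractNth (· * ·) (Fin.cons t r : Fin (n + 2) → T) =
      Fin.cons t (k.contractNth (· * ·) r) := by
  funext j
  refine Fin.cases ?_ (fun j => ?_) j
  · simp [Fin.contractNth]
  · simp [Fin.contractNth]

/-- The dimension shift. Freezing the first argument `t`, the product `t * r 0` becomes the left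
action on maps `T → Y`, and the remaining terms are those of the coboundary of `curry φ`, each with
its sign reversed because positions move by one. -/
theorem delta_cons {n : ℕ} (φ : Cochain T Y (n + 1)) (t : T) (r : Fin (n + 1) → T) :
    delta T Y (n + 1) φ (Fin.cons t r) =
      t • φ r - delta T (LinBimodule.{u, v} T Y) n (curry φ) r t := by
  have hd := congrArg (LinBimodule.eval t) (delta_apply (curry φ) r)
  rw [LinBimodule.eval_apply] at hd
  simp only [map_add, map_sum, map_smul, LinBimodule.eval_apply, LinBimodule.lsmul_apply,
    LinBimodule.rsmul_apply, curry_apply] at hd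
  have hi : Fin.init (Fin.cons t r : Fin (n + 2) → T) = Fin.cons t (Fin.init r) := by
    funext j
    refine Fin.cases ?_ (fun j => ?_) j
    · simp [Fin.init]
    · simp [Fin.init]
  have hl : (Fin.cons t r : Fin (n + 2) → T) (Fin.last (n + 1)) = r (Fin.last n) := rfl
  rw [hd, delta_apply, Fin.sum_univ_succ, hi, hl]
  simp only [Fin.cons_zero, Fin.tail_cons, Fin.castSucc_zero, contractNth_zero_cons,
    ← Fin.succ_castSucc, contractNth_succ_cons, Fin.val_zero, Fin.val_succ]
  -- The extra factor `-1` from the index shift is pulled out of every term, which yields the minus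
  -- sign before the curried coboundary.
  simp only [pow_succ _ (_ + 1), mul_neg, mul_one, neg_smul, Finset.sum_neg_distrib, zero_add,
    pow_one, one_smul]
  abel

end Curry

end Hochschild

end

/-! ### The averaging homotopy -/

noncomputable section

namespace Hochschild

section SMulMap

variable {S Y : Type*} [NormedRing S] [NormedAlgebra ℂ S] [NormedAddCommGroup Y] [NormedSpace ℂ Y]
  [Module S Y] [IsScalarTower ℂ S Y] [ContinuousSMul S Y]

/-- The action of an element of an algebra, as a bounded linear map. -/
def smulCLM (Y : Type*) [NormedAddCommGroup Y] [NormedSpace ℂ Y]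
    [Module S Y] [IsScalarTower ℂ S Y] [ContinuousSMul S Y] (s : S) : Y →L[ℂ] Y where
  toFun y := s • y
  map_add' := smul_add s
  map_smul' c y := smul_comm s c y
  cont := continuous_const_smul s

end SMulMap

universe u v

variable {T : Type u} [NormedRing T] [NormedAlgebra ℂ T]

section LeftModule

variable {Y Z : Type (max u v)}
    [NormedAddCommGroup Y] [NormedSpace ℂ Y] [NormedAddCommGroup Z] [NormedSpace ℂ Z]

/-- Composition with a bounded linear map on the left. -/
def postcomp (c : Y →L[ℂ] Z) : LinBimodule.{u, v} T Y →L[ℂ] LinBimodule.{u, v} T Z :=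
  ContinuousLinearMap.compL ℂ T Y Z c

@[simp] theorem postcomp_apply (c : Y →L[ℂ] Z) (L : LinBimodule.{u, v} T Y) (t : T) :
    postcomp c L t = c (L t) := rfl

theorem curry_pull (c : Y →L[ℂ] Z) {n : ℕ} (φ : Cochain T Y (n + 1)) :
    curry (pull (.id ℂ T) c (n + 1) φ) = pull (.id ℂ T) (postcomp c) n (curry φ) := rfl

variable [Module T Y] [IsScalarTower ℂ T Y] [ContinuousSMul T Y]
  [Module T Z] [IsScalarTower ℂ T Z] [ContinuousSMul T Z]

/-- The map `L ↦ (t ↦ e L(et) + f L(ft))`. -/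
def average (e f : T) : LinBimodule.{u, v} T Y →L[ℂ] LinBimodule.{u, v} T Y :=
  (ContinuousLinearMap.compL ℂ T Y Y (smulCLM Y e)).comp
      ((ContinuousLinearMap.compL ℂ T T Y).flip (ContinuousLinearMap.mul ℂ T e)) +
    (ContinuousLinearMap.compL ℂ T Y Y (smulCLM Y f)).comp
      ((ContinuousLinearMap.compL ℂ T T Y).flip (ContinuousLinearMap.mul ℂ T f))

theorem average_apply (e f : T) (L : LinBimodule.{u, v} T Y) (t : T) :
    average e f L t = e • L (e * t) + f • L (f * t) := rfl

/-- The map `L ↦ e L(e) + f L(f)`. -/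
def contraction (e f : T) : LinBimodule.{u, v} T Y →L[ℂ] Y :=
  (smulCLM Y e).comp (LinBimodule.eval e) + (smulCLM Y f).comp (LinBimodule.eval f)

theorem contraction_apply (e f : T) (L : LinBimodule.{u, v} T Y) :
    contraction e f L = e • L e + f • L f := rfl

/-- This measures how `contraction` fails to be left linear: linearity would give `t • contraction e
f L` instead. The discrepancy is the source of the `average` terms in the homotopy. -/
theorem contraction_smul (e f : T) (L : LinBimodule.{u, v} T Y) (t : T) :
    contraction e f (t • L) = average e f L t := rfl

/-- The map `y ↦ (t ↦ t y)`. -/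
def orbit : Y →L[ℂ] LinBimodule.{u, v} T Y :=
  LinearMap.mkContinuous₂ (LinearMap.mk₂ ℂ (fun (y : Y) (t : T) => t • y)
    (fun _ _ _ => smul_add _ _ _) (fun _ _ _ => smul_comm _ _ _)
    (fun _ _ _ => add_smul _ _ _) (fun _ _ _ => smul_assoc _ _ _))
    (exists_norm_smul_le_of_continuousSMul T Y).choose
    (fun y t => by
      have h := (exists_norm_smul_le_of_continuousSMul T Y).choose_spec t y
      rw [mul_assoc, mul_comm ‖y‖, ← mul_assoc]
      exact h)

@[simp] theorem orbit_apply (y : Y) (t : T) : (orbit y : LinBimodule.{u, v} T Y) t = t • y := rfl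

theorem average_orbit {e f : T} (hef : e * e + f * f = 1) (y : Y) (t : T) :
    average e f (orbit y : LinBimodule.{u, v} T Y) t = t • y := by
  rw [average_apply, orbit_apply, orbit_apply, smul_smul, smul_smul, ← mul_assoc, ← mul_assoc,
    ← add_smul, ← add_mul, hef, one_mul]

/-- The contraction splits the embedding of `Y` into the maps `T → Y`; this is where a homotopy
comes from. -/
theorem contraction_orbit {e f : T} (hef : e * e + f * f = 1) (y : Y) :
    contraction e f (orbit y : LinBimodule.{u, v} T Y) = y := by
  rw [contraction_apply, orbit_apply, orbit_apply, smul_smul, smul_smul, ← add_smul, hef, one_smul]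

theorem average_postcomp (e f : T) (c : Y →L[ℂ] Z) (hc : ∀ (t : T) (y : Y), c (t • y) = t • c y)
    (L : LinBimodule.{u, v} T Y) : average e f (postcomp c L) = postcomp c (average e f L) := by
  ext t
  simp only [average_apply, postcomp_apply, map_add, hc]

theorem contraction_postcomp (e f : T) (c : Y →L[ℂ] Z)
    (hc : ∀ (t : T) (y : Y), c (t • y) = t • c y) (L : LinBimodule.{u, v} T Y) :
    contraction e f (postcomp c L) = c (contraction e f L) := by
  simp only [contraction_apply, postcomp_apply, map_add, hc]

/-- The contracting homotopy of the bar complex which averages over `e` and `f`: its value at `φ` is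
`(t₁, …, tₙ) ↦ ∑ᵢ (-1)ⁱ ∑ p₀ φ(p₀ t₁ p₁, …, pᵢ₋₁ tᵢ pᵢ, pᵢ, tᵢ₊₁, …, tₙ)`, where the `pⱼ` run
over `e` and `f`. -/
def homotopy (e f : T) : (n : ℕ) → (Y : Type (max u v)) → [NormedAddCommGroup Y] →
    [NormedSpace ℂ Y] → [Module T Y] → [IsScalarTower ℂ T Y] → [ContinuousSMul T Y] →
    Cochain T Y (n + 1) → Cochain T Y n
  | 0, _, _, _, _, _, _, φ => pull (.id ℂ T) (contraction e f) 0 (curry φ)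
  | n + 1, Y, _, _, _, _, _, φ => pull (.id ℂ T) (contraction e f) (n + 1) (curry φ) -
      uncurry (pull (.id ℂ T) (average e f) n
        (homotopy e f n (LinBimodule.{u, v} T Y) (curry φ)))

theorem homotopy_zero_apply (e f : T) (φ : Cochain T Y 1) (v : Fin 0 → T) :
    homotopy.{u, v} e f 0 Y φ v = contraction e f (curry φ v) := rfl

theorem homotopy_succ_cons (e f : T) {n : ℕ} (φ : Cochain T Y (n + 2)) (t : T) (r : Fin n → T) :
    homotopy.{u, v} e f (n + 1) Y φ (Fin.cons t r) = contraction e f (curry φ (Fin.cons t r)) -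
      average e f (homotopy.{u, v} e f n (LinBimodule.{u, v} T Y) (curry φ) r) t := rfl

theorem homotopy_sub (e f : T) (n : ℕ) : ∀ (Y : Type (max u v)) [NormedAddCommGroup Y]
    [NormedSpace ℂ Y] [Module T Y] [IsScalarTower ℂ T Y] [ContinuousSMul T Y]
    (φ ψ : Cochain T Y (n + 1)), homotopy.{u, v} e f n Y (φ - ψ) =
      homotopy.{u, v} e f n Y φ - homotopy.{u, v} e f n Y ψ := by
  induction n with
  | zero =>
    intro Y _ _ _ _ _ φ ψ
    ext v
    exact map_sub (contraction e f) (curry φ v) (curry ψ v)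
  | succ n ih =>
    intro Y _ _ _ _ _ φ ψ
    refine ext_cons fun t r => ?_
    have h : curry (φ - ψ) = curry φ - curry ψ := rfl
    simp only [_root_.sub_apply, homotopy_succ_cons, h, ih, map_sub, LinBimodule.sub_apply]
    abel

/-- The homotopy is natural for left module maps, as it uses the left action alone. The case needed
is `orbit`, which appears when a coboundary is curried. -/
theorem homotopy_pull (e f : T) (n : ℕ) : ∀ (Y Z : Type (max u v)) [NormedAddCommGroup Y]
    [NormedSpace ℂ Y] [Module T Y] [IsScalarTower ℂ T Y] [ContinuousSMul T Y]
    [NormedAddCommGroup Z] [NormedSpace ℂ Z] [Module T Z] [IsScalarTower ℂ T Z]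
    [ContinuousSMul T Z] (c : Y →L[ℂ] Z) (_ : ∀ (t : T) (y : Y), c (t • y) = t • c y)
    (φ : Cochain T Y (n + 1)), homotopy.{u, v} e f n Z (pull (.id ℂ T) c (n + 1) φ) =
      pull (.id ℂ T) c n (homotopy.{u, v} e f n Y φ) := by
  induction n with
  | zero =>
    intro Y Z _ _ _ _ _ _ _ _ _ _ c hc φ
    ext v
    exact contraction_postcomp e f c hc (curry φ v)
  | succ n ih =>
    intro Y Z _ _ _ _ _ _ _ _ _ _ c hc φ
    refine ext_cons fun t r => ?_
    -- Left multiplication on maps `T → Y` acts on the argument, so postcomposition respects it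
    -- definitionally.
    rw [homotopy_succ_cons, curry_pull, ih _ _ (postcomp c) (fun t L => rfl)]
    simp only [pull_apply, ContinuousLinearMap.id_apply, average_postcomp e f c hc,
      contraction_postcomp e f c hc, homotopy_succ_cons, map_sub, postcomp_apply]

end LeftModule

/-! ### The homotopy identity and the corners of the relative projection -/

section Bimodule

variable {Y : Type (max u v)} [NormedAddCommGroup Y] [NormedSpace ℂ Y]
  [Module T Y] [IsScalarTower ℂ T Y] [ContinuousSMul T Y]
  [Module Tᵐᵒᵖ Y] [IsScalarTower ℂ Tᵐᵒᵖ Y] [ContinuousSMul Tᵐᵒᵖ Y]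

/-- The projection onto the cochains which are relative to the span of `e` and `f`: its value at
`φ` is `(t₁, …, tₙ) ↦ ∑ p₀ φ(p₀ t₁ p₁, …, pₙ₋₁ tₙ pₙ) pₙ`, where the `pⱼ` run over `e`
and `f`. -/
def relativize (e f : T) : (n : ℕ) → (Y : Type (max u v)) → [NormedAddCommGroup Y] →
    [NormedSpace ℂ Y] → [Module T Y] → [IsScalarTower ℂ T Y] → [ContinuousSMul T Y] →
    [Module Tᵐᵒᵖ Y] → [IsScalarTower ℂ Tᵐᵒᵖ Y] → [ContinuousSMul Tᵐᵒᵖ Y] →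
    Cochain T Y n → Cochain T Y n
  | 0, Y, _, _, _, _, _, _, _, _, φ =>
      pull (.id ℂ T) ((smulCLM Y e).comp (smulCLM Y (op e)) +
        (smulCLM Y f).comp (smulCLM Y (op f))) 0 φ
  | n + 1, Y, _, _, _, _, _, _, _, _, φ => uncurry (pull (.id ℂ T) (average e f) n
      (relativize e f n (LinBimodule.{u, v} T Y) (curry φ)))

theorem relativize_zero_apply (e f : T) (φ : Cochain T Y 0) (v : Fin 0 → T) :
    relativize.{u, v} e f 0 Y φ v = e • op e • φ v + f • op f • φ v := rfl

theorem relativize_succ_cons (e f : T) {n : ℕ} (φ : Cochain T Y (n + 1)) (t : T) (r : Fin n → T) :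
    relativize.{u, v} e f (n + 1) Y φ (Fin.cons t r) =
      average e f (relativize.{u, v} e f n (LinBimodule.{u, v} T Y) (curry φ) r) t := rfl

theorem curry_delta {n : ℕ} (φ : Cochain T Y (n + 1)) :
    curry (delta T Y (n + 1) φ) = pull (.id ℂ T) orbit (n + 1) φ -
      delta T (LinBimodule.{u, v} T Y) n (curry φ) := by
  ext r t
  rw [curry_apply, delta_cons]
  rfl

variable [SMulCommClass T Tᵐᵒᵖ Y]

/-- The contraction respects the right action, so only the first term of the coboundary is affected,
and `contraction_smul` evaluates its defect. -/
theorem delta_contraction (e f : T) {n : ℕ} (φ : Cochain T (LinBimodule.{u, v} T Y) n)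
    (t : T) (r : Fin n → T) :
    delta T Y n (pull (.id ℂ T) (contraction e f) n φ) (Fin.cons t r) =
      t • contraction e f (φ r) +
        contraction e f (delta T (LinBimodule.{u, v} T Y) n φ (Fin.cons t r)) -
          average e f (φ r) t := by
  have h := delta_pull_sub (.id ℂ T) (contraction e f : LinBimodule.{u, v} T Y →L[ℂ] Y)
    (fun _ _ => rfl) (fun d L => by
      simp only [contraction_apply, LinBimodule.rsmul_apply, smul_add, smul_comm e,
        smul_comm f, ContinuousLinearMap.id_apply]) φ (Fin.cons t r)
  simp only [pull_apply, ContinuousLinearMap.id_apply, Fin.cons_zero, Fin.cons_succ,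
    contraction_smul] at h
  rw [sub_eq_iff_eq_add.1 h]
  abel

/-- Unlike `contraction`, `average` is a bimodule map, so it commutes with the coboundary; the rest
is the dimension shift. -/
theorem delta_uncurry_average (e f : T) {n : ℕ} (φ : Cochain T (LinBimodule.{u, v} T Y) n)
    (t : T) (r : Fin (n + 1) → T) :
    delta T Y (n + 1) (uncurry (pull (.id ℂ T) (average e f) n φ)) (Fin.cons t r) =
      t • uncurry (pull (.id ℂ T) (average e f) n φ) r -
        average e f (delta T (LinBimodule.{u, v} T Y) n φ r) t := by
  rw [delta_cons, curry_uncurry, delta_pull (.id ℂ T) (average e f) (fun _ _ => rfl) _ _ φ]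
  · rfl
  · intro d L
    ext t
    simp only [average_apply, LinBimodule.lsmul_apply, ContinuousLinearMap.id_apply, mul_assoc]
  · intro d L
    ext t
    simp only [average_apply, LinBimodule.rsmul_apply, smul_add, smul_comm e,
        smul_comm f, ContinuousLinearMap.id_apply]

theorem homotopy_delta_cons {e f : T} (hef : e * e + f * f = 1) {n : ℕ}
    (φ : Cochain T Y (n + 1)) (t : T) (r : Fin n → T) :
    homotopy.{u, v} e f (n + 1) Y (delta T Y (n + 1) φ) (Fin.cons t r) =
      φ (Fin.cons t r) -
        contraction e f (delta T (LinBimodule.{u, v} T Y) n (curry φ) (Fin.cons t r)) -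
        t • homotopy.{u, v} e f n Y φ r +
        average e f (homotopy.{u, v} e f n (LinBimodule.{u, v} T Y)
          (delta T (LinBimodule.{u, v} T Y) n (curry φ)) r) t := by
  rw [homotopy_succ_cons, curry_delta, homotopy_sub,
    homotopy_pull e f n Y (LinBimodule.{u, v} T Y) orbit
      (fun s y => by ext t; simp [mul_smul])]
  simp only [_root_.sub_apply, map_sub, pull_apply, LinBimodule.sub_apply,
    average_orbit hef, contraction_orbit hef, ContinuousLinearMap.id_apply]
  abel

theorem homotopy_delta_zero {e f : T} (hef : e * e + f * f = 1) (φ : Cochain T Y 0) :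
    homotopy.{u, v} e f 0 Y (delta T Y 0 φ) = φ - relativize.{u, v} e f 0 Y φ := by
  ext v
  have h : ∀ t : T, curry (delta T Y 0 φ) v t = t • φ v - op t • φ v := fun t => by
    rw [curry_apply, delta_apply, Subsingleton.elim (Fin.tail _) v, Subsingleton.elim (Fin.init _) v]
    simp [sub_eq_add_neg]
  rw [homotopy_zero_apply, contraction_apply, h, h, _root_.sub_apply, relativize_zero_apply,
    smul_sub, smul_sub, smul_smul, smul_smul, sub_add_sub_comm, ← add_smul, hef, one_smul]

/-- The recursive formulas for `δh` and `hδ` share contraction terms and terms `t • homotopy e f n Y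
φ r` of opposite sign. What is left is `φ` and the average of the same identity one degree lower,
for `curry φ`; hence the induction over all bimodules at once. -/
theorem delta_homotopy_add_homotopy_delta {e f : T} (hef : e * e + f * f = 1) (n : ℕ) :
    ∀ (Y : Type (max u v)) [NormedAddCommGroup Y] [NormedSpace ℂ Y]
      [Module T Y] [IsScalarTower ℂ T Y] [ContinuousSMul T Y]
      [Module Tᵐᵒᵖ Y] [IsScalarTower ℂ Tᵐᵒᵖ Y] [ContinuousSMul Tᵐᵒᵖ Y]
      [SMulCommClass T Tᵐᵒᵖ Y] (φ : Cochain T Y (n + 1)),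
      delta T Y n (homotopy.{u, v} e f n Y φ) +
        homotopy.{u, v} e f (n + 1) Y (delta T Y (n + 1) φ) =
          φ - relativize.{u, v} e f (n + 1) Y φ := by
  induction n with
  | zero =>
    intro Y _ _ _ _ _ _ _ _ _ φ
    refine ext_cons fun t r => ?_
    rw [_root_.add_apply, homotopy_delta_cons hef, homotopy_delta_zero hef]
    simp only [homotopy, delta_contraction, _root_.sub_apply, map_sub,
      LinBimodule.sub_apply, relativize_succ_cons, pull_apply, ContinuousLinearMap.id_apply]
    abel
  | succ n ih =>
    intro Y _ _ _ _ _ _ _ _ _ φ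
    refine ext_cons fun t r => ?_
    rw [_root_.add_apply, homotopy_delta_cons hef,
      eq_sub_of_add_eq' (ih (LinBimodule.{u, v} T Y) (curry φ))]
    simp only [homotopy, map_sub, delta_contraction, delta_uncurry_average, _root_.sub_apply,
      LinBimodule.sub_apply, relativize_succ_cons, pull_apply, ContinuousLinearMap.id_apply,
      smul_sub]
    abel

/-- For orthogonal idempotents `e` and `f` with sum `1` and `f T e = 0`, the diagonal corners of the
relative part of a cochain, and the vanishing of one of the other corners. -/
theorem corner_relativize {e f : T} (he : e * e = e) (hf : f * f = f) (hef : e + f = 1)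
    (hfe : ∀ t, f * t * e = 0) (n : ℕ) :
    ∀ (Y : Type (max u v)) [NormedAddCommGroup Y] [NormedSpace ℂ Y]
      [Module T Y] [IsScalarTower ℂ T Y] [ContinuousSMul T Y]
      [Module Tᵐᵒᵖ Y] [IsScalarTower ℂ Tᵐᵒᵖ Y] [ContinuousSMul Tᵐᵒᵖ Y]
      [SMulCommClass T Tᵐᵒᵖ Y] (φ : Cochain T Y n) (v : Fin n → T),
      e • op e • relativize.{u, v} e f n Y φ v = e • op e • φ (fun j => e * v j * e) ∧
      f • op f • relativize.{u, v} e f n Y φ v = f • op f • φ (fun j => f * v j * f) ∧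
      f • op e • relativize.{u, v} e f n Y φ v = 0 := by
  have h1 : e * f = 0 := by rw [eq_sub_of_add_eq' hef, mul_sub, he, mul_one, sub_self]
  have h2 : f * e = 0 := by rw [eq_sub_of_add_eq' hef, sub_mul, he, one_mul, sub_self]
  induction n with
  | zero =>
    intro Y _ _ _ _ _ _ _ _ _ φ v
    have key : ∀ (p q r s : T) (y : Y), p • op q • r • op s • y = (p * r) • op (s * q) • y :=
      fun p q r s y => by rw [← smul_comm r (op q), smul_smul, smul_smul, ← op_mul]
    rw [relativize_zero_apply, Subsingleton.elim (fun j => e * v j * e) v,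
      Subsingleton.elim (fun j => f * v j * f) v]
    simp [key, he, hf, h1, h2]
  | succ n ih =>
    intro Y _ _ _ _ _ _ _ _ _ φ v
    obtain ⟨t, r, rfl⟩ : ∃ t r, v = Fin.cons t r := ⟨_, _, (Fin.cons_self_tail v).symm⟩
    obtain ⟨i1, i2, i3⟩ := ih (LinBimodule.{u, v} T Y) (curry φ) r
    set Λ := relativize.{u, v} e f n (LinBimodule.{u, v} T Y) (curry φ) r with hΛ
    -- Left multiplication by `e` on a map `T → Y` is precomposition with `s ↦ s * e`. The inductive
    -- statements about left corners thus describe `Λ` on `T e` and `T f`. The condition `e Y f = 0`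
    -- would not pass to maps `T → Y`, so the induction avoids it.
    have j1 : ∀ s, op e • Λ (s * e) = op e • φ (Fin.cons (s * e) fun j => e * r j * e) :=
      fun s => congrArg (LinBimodule.eval s) i1
    have j2 : ∀ s, op f • Λ (s * f) = op f • φ (Fin.cons (s * f) fun j => f * r j * f) :=
      fun s => congrArg (LinBimodule.eval s) i2
    have j3 : ∀ s, op e • Λ (s * f) = 0 := fun s => congrArg (LinBimodule.eval s) i3
    have hc : ∀ p : T, (fun j => p * (Fin.cons t r : Fin (n + 1) → T) j * p) =
        Fin.cons (p * t * p) fun j => p * r j * p := fun p => by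
      funext j
      refine Fin.cases rfl (fun j => rfl) j
    have hs : ∀ s : T, Λ s = Λ (s * e) + Λ (s * f) := fun s => by
      rw [← LinBimodule.map_add, ← mul_add, hef, mul_one]
    have hr : ∀ (p : T) (y z : Y), op p • (e • y + f • z) = e • op p • y + f • op p • z :=
      fun p y z => by rw [smul_add, smul_comm e, smul_comm f]
    rw [relativize_succ_cons, ← hΛ, average_apply, hc, hc]
    refine ⟨?_, ?_, ?_⟩
    · rw [hr, smul_add, smul_smul, smul_smul, he, h1, zero_smul, add_zero, hs (e * t), smul_add,
        j1, j3, add_zero]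
    -- Triangularity enters: the summand of `Λ (f * t)` at `f * t * e` is zero.
    · rw [hr, smul_add, smul_smul, smul_smul, hf, h2, zero_smul, zero_add, hs (f * t), hfe,
        LinBimodule.map_zero, zero_add, j2]
    · rw [hr, smul_add, smul_smul, smul_smul, hf, h2, zero_smul, zero_add, hs (f * t), hfe,
        LinBimodule.map_zero, zero_add, j3, smul_zero]

/-- In the Peirce decomposition of the value, the two off-diagonal corners vanish for different
reasons: `f · e` by triangularity of the algebra, `e · f` by the hypothesis on the bimodule. -/
theorem relativize_apply {e f : T} (he : e * e = e) (hf : f * f = f) (hef : e + f = 1)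
    (hfe : ∀ t, f * t * e = 0) (hY : ∀ y : Y, e • op f • y = 0) {n : ℕ} (φ : Cochain T Y n)
    (v : Fin n → T) : relativize.{u, v} e f n Y φ v =
      e • op e • φ (fun j => e * v j * e) + f • op f • φ (fun j => f * v j * f) := by
  obtain ⟨h1, h2, h3⟩ := corner_relativize.{u, v} he hf hef hfe n Y φ v
  have h : ∀ y : Y, y = e • op e • y + e • op f • y + (f • op e • y + f • op f • y) := fun y => by
    rw [← smul_add, ← smul_add, ← add_smul, ← add_smul, ← op_add, hef, op_one, one_smul, one_smul]
  rw [← h1, ← h2]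
  conv_lhs => rw [h (relativize.{u, v} e f n Y φ v), h3, hY, add_zero, zero_add]

end Bimodule

/-! ### Cocycles are cohomologous to block diagonal ones -/

section Coboundary

theorem sub_mem_coboundaries_of_universe {Y : Type (max u v)} [NormedAddCommGroup Y]
    [NormedSpace ℂ Y] [Module T Y] [IsScalarTower ℂ T Y] [ContinuousSMul T Y]
    [Module Tᵐᵒᵖ Y] [IsScalarTower ℂ Tᵐᵒᵖ Y] [ContinuousSMul Tᵐᵒᵖ Y] [SMulCommClass T Tᵐᵒᵖ Y]
    {e f : T} (he : e * e = e) (hf : f * f = f) (hef : e + f = 1)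
    (hfe : ∀ t, f * t * e = 0) (hY : ∀ y : Y, e • op f • y = 0) {n : ℕ} {φ ψ : Cochain T Y n}
    (hφ : φ ∈ cocycles T Y n)
    (hψ : ∀ v, ψ v = e • op e • φ (fun j => e * v j * e) + f • op f • φ (fun j => f * v j * f)) :
    φ - ψ ∈ coboundaries T Y n := by
  have hs : e * e + f * f = 1 := by rw [he, hf, hef]
  obtain rfl : ψ = relativize.{u, v} e f n Y φ :=
    ContinuousMultilinearMap.ext fun v => by
      rw [hψ, relativize_apply.{u, v} he hf hef hfe hY]
  have h0 : ∀ m, homotopy.{u, v} e f m Y 0 = 0 := fun m => by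
    simpa using homotopy_sub.{u, v} e f m Y 0 0
  have hφ' : delta T Y n φ = 0 := hφ
  cases n with
  | zero =>
    rw [← homotopy_delta_zero hs, hφ', h0]
    exact Submodule.zero_mem _
  | succ n =>
    rw [← delta_homotopy_add_homotopy_delta hs, hφ', h0, add_zero]
    exact ⟨_, rfl⟩

/-- The recursion needs the maps `T → Y` to lie in the universe of `Y`. An arbitrary `X` is replaced
by the isomorphic bimodule `ULift X`, and the result is carried back. -/
theorem sub_mem_coboundaries {X : Type v} [NormedAddCommGroup X]
    [NormedSpace ℂ X] [Module T X] [IsScalarTower ℂ T X] [ContinuousSMul T X]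
    [Module Tᵐᵒᵖ X] [IsScalarTower ℂ Tᵐᵒᵖ X] [ContinuousSMul Tᵐᵒᵖ X] [SMulCommClass T Tᵐᵒᵖ X]
    {e f : T} (he : e * e = e) (hf : f * f = f) (hef : e + f = 1)
    (hfe : ∀ t, f * t * e = 0) (hX : ∀ x : X, e • op f • x = 0) {n : ℕ} {φ ψ : Cochain T X n}
    (hφ : φ ∈ cocycles T X n)
    (hψ : ∀ v, ψ v = e • op e • φ (fun j => e * v j * e) + f • op f • φ (fun j => f * v j * f)) :
    φ - ψ ∈ coboundaries T X n := by
  have : ContinuousSMul T (ULift.{u} X) := ⟨continuous_uliftUp.comp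
    (continuous_fst.smul (continuous_uliftDown.comp continuous_snd))⟩
  have : ContinuousSMul Tᵐᵒᵖ (ULift.{u} X) := ⟨continuous_uliftUp.comp
    (continuous_fst.smul (continuous_uliftDown.comp continuous_snd))⟩
  have : SMulCommClass T Tᵐᵒᵖ (ULift.{u} X) :=
    ⟨fun s t x => congrArg ULift.up (smul_comm s t x.down)⟩
  let d : ULift.{u} X →L[ℂ] X := (ContinuousLinearEquiv.ulift : ULift.{u} X ≃L[ℂ] X)
  let c : X →L[ℂ] ULift.{u} X := (ContinuousLinearEquiv.ulift : ULift.{u} X ≃L[ℂ] X).symm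
  have key : pull (.id ℂ T) c n φ - pull (.id ℂ T) c n ψ ∈ coboundaries T (ULift.{u} X) n := by
    refine sub_mem_coboundaries_of_universe.{u, v} he hf hef hfe
      (fun y => congrArg ULift.up (hX y.down)) ?_ fun v => ?_
    · have hφ' : delta T X n φ = 0 := hφ
      have h := delta_pull (.id ℂ T) c (fun _ _ => rfl) (fun _ _ => rfl) (fun _ _ => rfl) φ
      rw [hφ', map_zero] at h
      exact h
    · exact congrArg ULift.up (hψ v)
  cases n with
  | zero =>
    have h : pull (.id ℂ T) c 0 φ - pull (.id ℂ T) c 0 ψ = 0 := key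
    have h2 := congrArg (pull (.id ℂ T) d 0) h
    rw [map_zero] at h2
    exact h2
  | succ n =>
    obtain ⟨χ, hχ⟩ := key
    refine ⟨pull (.id ℂ T) d n χ, ?_⟩
    rw [delta_pull (.id ℂ T) d (fun _ _ => rfl) (fun _ _ => rfl) (fun _ _ => rfl), hχ]
    rfl

end Coboundary

end Hochschild

end

/-! ### Induced maps on cohomology, and corners -/

noncomputable section

namespace Hochschild

section Cohomology

variable {A D X Y : Type*} [NormedRing A] [NormedAlgebra ℂ A] [NormedRing D] [NormedAlgebra ℂ D]
  [NormedAddCommGroup X] [NormedSpace ℂ X] [NormedAddCommGroup Y] [NormedSpace ℂ Y]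
  [Module A X] [IsScalarTower ℂ A X] [ContinuousSMul A X]
  [Module Aᵐᵒᵖ X] [IsScalarTower ℂ Aᵐᵒᵖ X] [ContinuousSMul Aᵐᵒᵖ X]
  [Module D Y] [IsScalarTower ℂ D Y] [ContinuousSMul D Y]
  [Module Dᵐᵒᵖ Y] [IsScalarTower ℂ Dᵐᵒᵖ Y] [ContinuousSMul Dᵐᵒᵖ Y]

/-- The map `pull i c` on cocycles. -/
def pullCocycles (i : D →L[ℂ] A) (c : X →L[ℂ] Y) (hi : ∀ s t, i (s * t) = i s * i t)
    (hl : ∀ (d : D) (x : X), c (i d • x) = d • c x)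
    (hr : ∀ (d : D) (x : X), c (op (i d) • x) = op d • c x) (n : ℕ) :
    cocycles A X n →L[ℂ] cocycles D Y n :=
  ((pull i c n).comp (cocycles A X n).subtypeL).codRestrict _ fun φ => by
    have hφ : delta A X n φ = 0 := φ.2
    change delta D Y n (pull i c n φ) = 0
    rw [delta_pull i c hi hl hr, hφ, map_zero]

/-- The map on cohomology induced by `pull i c`. -/
def pullCohomology (i : D →L[ℂ] A) (c : X →L[ℂ] Y) (hi : ∀ s t, i (s * t) = i s * i t)
    (hl : ∀ (d : D) (x : X), c (i d • x) = d • c x)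
    (hr : ∀ (d : D) (x : X), c (op (i d) • x) = op d • c x) (n : ℕ) :
    Cohomology A X n →L[ℂ] Cohomology D Y n :=
  Submodule.liftQL _ ((Submodule.mkQL _).comp (pullCocycles i c hi hl hr n)) fun φ hφ => by
    refine (Submodule.Quotient.mk_eq_zero _).2 ?_
    change pull i c n φ ∈ coboundaries D Y n
    have hφ' : (φ : Cochain A X n) ∈ coboundaries A X n := hφ
    cases n with
    | zero =>
      have h0 : (φ : Cochain A X 0) = 0 := hφ'
      rw [h0, map_zero]
      exact Submodule.zero_mem _
    | succ n =>
      obtain ⟨χ, hχ⟩ := hφ'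
      exact ⟨pull i c n χ, by rw [delta_pull i c hi hl hr, hχ]⟩

theorem mk_eq_mk_of_sub_mem {n : ℕ} {φ ψ : cocycles A X n}
    (h : (φ : Cochain A X n) - ψ ∈ coboundaries A X n) :
    (Submodule.Quotient.mk φ : Cohomology A X n) = Submodule.Quotient.mk ψ :=
  (Submodule.Quotient.eq _).2 h

end Cohomology

section Corner

variable {A T : Type*} [NormedRing T] [NormedAlgebra ℂ T] [NormedRing A] [NormedAlgebra ℂ A]
  (i : CornerHom A T) (X : Type*) [NormedAddCommGroup X] [NormedSpace ℂ X]
    [Module T X] [IsScalarTower ℂ T X] [ContinuousSMul T X]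
    [Module Tᵐᵒᵖ X] [IsScalarTower ℂ Tᵐᵒᵖ X] [ContinuousSMul Tᵐᵒᵖ X]

/-- A continuous homomorphism of algebras, as a bounded linear map. -/
def _root_.CornerHom.toCLM : A →L[ℂ] T where
  toFun := i
  map_add' := i.map_add
  map_smul' := i.map_smul
  cont := i.continuous

/-- The projection `x ↦ i(1) x i(1)` onto the corner. -/
def cornerProj : X →L[ℂ] Corner i X where
  toFun x := ⟨i 1 • op (i 1) • x, x, rfl⟩
  map_add' x y := Corner.ext
    (((smulCLM X (i 1)).comp (smulCLM X (op (i 1)))).map_add x y)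
  map_smul' c x := Corner.ext
    (((smulCLM X (i 1)).comp (smulCLM X (op (i 1)))).map_smul c x)
  cont := Continuous.subtype_mk ((continuous_const_smul (i 1)).comp
    (continuous_const_smul (op (i 1)))) _

/-- The inclusion of the corner. -/
def cornerVal : Corner i X →L[ℂ] X where
  toFun x := x.1
  map_add' := Corner.val_add
  map_smul' := Corner.val_smul
  cont := Corner.continuous_val

variable {X}

theorem cornerProj_val (x : X) : (cornerProj i X x).1 = i 1 • op (i 1) • x := rfl

variable [SMulCommClass T Tᵐᵒᵖ X]

theorem cornerProj_smul (a : A) (x : X) : cornerProj i X (i a • x) = a • cornerProj i X x := by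
  ext
  rw [Corner.val_lsmul, cornerProj_val, cornerProj_val, ← smul_comm (i a) (op (i 1)), smul_smul,
    smul_smul, i.one_mul, i.mul_one]

theorem cornerProj_op_smul (a : A) (x : X) :
    cornerProj i X (op (i a) • x) = op a • cornerProj i X x := by
  ext
  rw [Corner.val_rsmul, cornerProj_val, cornerProj_val, unop_op, ← smul_comm (i 1) (op (i a)),
    smul_smul (op (i 1)), smul_smul (op (i a)), ← op_mul, ← op_mul, i.one_mul, i.mul_one]

theorem cornerProj_cornerVal (x : Corner i X) : cornerProj i X (cornerVal i X x) = x := by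
  ext
  change i 1 • op (i 1) • x.1 = x.1
  rw [Corner.op_one_smul_val, Corner.one_smul_val]

end Corner

end Hochschild

/-! ### Restriction to and inflation from the diagonal -/

namespace TriangularAlgebra

open Hochschild

variable (A M B : Type*)
    [NormedRing A] [NormedAlgebra ℂ A] [NormedRing B] [NormedAlgebra ℂ B]
    [NormedAddCommGroup M] [NormedSpace ℂ M]
    [Module A M] [IsScalarTower ℂ A M] [IsBoundedSMul A M]
    [Module Bᵐᵒᵖ M] [IsScalarTower ℂ Bᵐᵒᵖ M] [IsBoundedSMul Bᵐᵒᵖ M]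
    [SMulCommClass A Bᵐᵒᵖ M]

/-- The upper left entry, as a bounded linear map. -/
def projA : TriangularAlgebra A M B →L[ℂ] A :=
  LinearMap.mkContinuous ⟨⟨fun t => t.a, fun _ _ => rfl⟩, fun _ _ => rfl⟩ 1 fun t => by
    change ‖t.a‖ ≤ 1 * ‖t‖
    rw [norm_def]
    linarith [norm_nonneg t.m, norm_nonneg t.b]

/-- The lower right entry, as a bounded linear map. -/
def projB : TriangularAlgebra A M B →L[ℂ] B :=
  LinearMap.mkContinuous ⟨⟨fun t => t.b, fun _ _ => rfl⟩, fun _ _ => rfl⟩ 1 fun t => by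
    change ‖t.b‖ ≤ 1 * ‖t‖
    rw [norm_def]
    linarith [norm_nonneg t.m, norm_nonneg t.a]

variable {A M B}

theorem mul_inA_one (t : TriangularAlgebra A M B) : t * inA A M B 1 = inA A M B t.a := by
  ext <;> simp [inA]

theorem inB_one_mul (t : TriangularAlgebra A M B) : inB A M B 1 * t = inB A M B t.b := by
  ext <;> simp [inB]

theorem inA_one_mul_mul (t : TriangularAlgebra A M B) :
    inA A M B 1 * t * inA A M B 1 = inA A M B t.a := by
  ext <;> simp [inA]

theorem inB_one_mul_mul (t : TriangularAlgebra A M B) :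
    inB A M B 1 * t * inB A M B 1 = inB A M B t.b := by
  ext <;> simp [inB]

theorem inB_one_mul_inA_one (t : TriangularAlgebra A M B) :
    inB A M B 1 * t * inA A M B 1 = 0 := by
  ext <;> simp [inA, inB]

theorem inA_one_add_inB_one : inA A M B 1 + inB A M B 1 = 1 := by
  ext <;> simp [inA, inB]

theorem inA_mul_inB (a : A) (b : B) : inA A M B a * inB A M B b = 0 := by
  ext <;> simp [inA, inB]

theorem inB_mul_inA (a : A) (b : B) : inB A M B b * inA A M B a = 0 := by
  ext <;> simp [inA, inB]

variable {X : Type*} [NormedAddCommGroup X] [NormedSpace ℂ X]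
    [Module (TriangularAlgebra A M B) X] [IsScalarTower ℂ (TriangularAlgebra A M B) X]
    [ContinuousSMul (TriangularAlgebra A M B) X]
    [Module (TriangularAlgebra A M B)ᵐᵒᵖ X] [IsScalarTower ℂ (TriangularAlgebra A M B)ᵐᵒᵖ X]
    [ContinuousSMul (TriangularAlgebra A M B)ᵐᵒᵖ X]
    [SMulCommClass (TriangularAlgebra A M B) (TriangularAlgebra A M B)ᵐᵒᵖ X]

theorem cornerA_smul (t : TriangularAlgebra A M B) (x : Corner (inA A M B) X) :
    t • x.1 = inA A M B t.a • x.1 := by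
  conv_lhs => rw [← Corner.one_smul_val x, smul_smul, mul_inA_one]

theorem cornerB_op_smul (t : TriangularAlgebra A M B) (x : Corner (inB A M B) X) :
    op t • x.1 = op (inB A M B t.b) • x.1 := by
  conv_lhs => rw [← Corner.op_one_smul_val x, smul_smul, ← op_mul, inB_one_mul]

/-- For `x` in `e X e`, the part `x t f` lies in `e X f = 0`, so `x t = x t e`, and `t e` only sees
the upper left entry. Without this, inflation from `A` would not be a map of complexes. -/
theorem cornerA_op_smul (hX : ∀ x : X, inA A M B 1 • op (inB A M B 1) • x = 0)
    (t : TriangularAlgebra A M B) (x : Corner (inA A M B) X) :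
    op t • x.1 = op (inA A M B t.a) • x.1 := by
  have h : op (inB A M B 1) • op t • x.1 = 0 := by
    rw [← Corner.one_smul_val x, ← smul_comm (inA A M B 1) (op t),
      ← smul_comm (inA A M B 1) (op (inB A M B 1))]
    exact hX _
  rw [← mul_inA_one t, op_mul, mul_smul, ← add_zero (op (inA A M B 1) • op t • x.1), ← h,
    ← add_smul, ← op_add, inA_one_add_inB_one, op_one, one_smul]

/-- Dually, `e t x` lies in `e X f = 0` for `x` in `f X f`, so `t x = f t x`. -/
theorem cornerB_smul (hX : ∀ x : X, inA A M B 1 • op (inB A M B 1) • x = 0)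
    (t : TriangularAlgebra A M B) (x : Corner (inB A M B) X) :
    t • x.1 = inB A M B t.b • x.1 := by
  have h : inA A M B 1 • t • x.1 = 0 := by
    rw [← Corner.op_one_smul_val x, smul_comm t (op (inB A M B 1))]
    exact hX _
  rw [← inB_one_mul t, mul_smul, ← zero_add (inB A M B 1 • t • x.1), ← h,
    ← add_smul, inA_one_add_inB_one, one_smul]

theorem cornerProjA_cornerValB (x : Corner (inB A M B) X) :
    cornerProj (inA A M B) X (cornerVal (inB A M B) X x) = 0 := by
  ext
  change inA A M B 1 • op (inA A M B 1) • x.1 = 0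
  rw [← Corner.op_one_smul_val x, smul_smul (op _), ← op_mul, inB_mul_inA, op_zero, zero_smul,
    smul_zero]

theorem cornerProjB_cornerValA (x : Corner (inA A M B) X) :
    cornerProj (inB A M B) X (cornerVal (inA A M B) X x) = 0 := by
  ext
  change inB A M B 1 • op (inB A M B 1) • x.1 = 0
  rw [← Corner.op_one_smul_val x, smul_smul (op _), ← op_mul, inA_mul_inB, op_zero, zero_smul,
    smul_zero]

variable (A M B X) in
/-- Restriction of cochains to the diagonal corners, on cohomology. -/
def restrictCohomology (n : ℕ) : Cohomology (TriangularAlgebra A M B) X n →L[ℂ]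
    Cohomology A (Corner (inA A M B) X) n × Cohomology B (Corner (inB A M B) X) n :=
  (pullCohomology (inA A M B).toCLM (cornerProj (inA A M B) X) (inA A M B).map_mul
      (cornerProj_smul _) (cornerProj_op_smul _) n).prod
    (pullCohomology (inB A M B).toCLM (cornerProj (inB A M B) X) (inB A M B).map_mul
      (cornerProj_smul _) (cornerProj_op_smul _) n)

/-- Inflation of cochains from the diagonal corners, on cohomology. -/
def inflateCohomology (hX : ∀ x : X, inA A M B 1 • op (inB A M B 1) • x = 0) (n : ℕ) :
    Cohomology A (Corner (inA A M B) X) n × Cohomology B (Corner (inB A M B) X) n →L[ℂ]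
      Cohomology (TriangularAlgebra A M B) X n :=
  (pullCohomology (projA A M B) (cornerVal (inA A M B) X) (fun _ _ => rfl)
      (fun t x => (cornerA_smul t x).symm) (fun t x => (cornerA_op_smul hX t x).symm) n).coprod
    (pullCohomology (projB A M B) (cornerVal (inB A M B) X) (fun _ _ => rfl)
      (fun t x => (cornerB_smul hX t x).symm) (fun t x => (cornerB_op_smul t x).symm) n)

theorem restrictCohomology_inflateCohomology
    (hX : ∀ x : X, inA A M B 1 • op (inB A M B 1) • x = 0) (n : ℕ)
    (p : Cohomology A (Corner (inA A M B) X) n × Cohomology B (Corner (inB A M B) X) n) :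
    restrictCohomology A M B X n (inflateCohomology hX n p) = p := by
  obtain ⟨p, q⟩ := p
  obtain ⟨g, rfl⟩ := Submodule.Quotient.mk_surjective _ p
  obtain ⟨h, rfl⟩ := Submodule.Quotient.mk_surjective _ q
  refine Prod.ext (congrArg Submodule.Quotient.mk (Subtype.ext (ContinuousMultilinearMap.ext
    fun v => ?_))) (congrArg Submodule.Quotient.mk (Subtype.ext (ContinuousMultilinearMap.ext
    fun v => ?_)))
  -- The lower right entries of elements of `A` are zero. In degree `0` the cochain `h` need not
  -- vanish on the empty tuple, so its contribution is removed by the corner projection and not by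
  -- multilinearity.
  · change cornerProj (inA A M B) X (cornerVal (inA A M B) X (g.1 v) +
      cornerVal (inB A M B) X (h.1 fun _ => 0)) = g.1 v
    rw [map_add, cornerProj_cornerVal, cornerProjA_cornerValB, add_zero]
  · change cornerProj (inB A M B) X (cornerVal (inA A M B) X (g.1 fun _ => 0) +
      cornerVal (inB A M B) X (h.1 v)) = h.1 v
    rw [map_add, cornerProj_cornerVal, cornerProjB_cornerValA, zero_add]

/-- On cocycles the composite only extracts the block diagonal part, which differs from the cocycle
by a coboundary. -/
theorem inflateCohomology_restrictCohomology
    (hX : ∀ x : X, inA A M B 1 • op (inB A M B 1) • x = 0) (n : ℕ)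
    (p : Cohomology (TriangularAlgebra A M B) X n) :
    inflateCohomology hX n (restrictCohomology A M B X n p) = p := by
  obtain ⟨φ, rfl⟩ := Submodule.Quotient.mk_surjective _ p
  refine (mk_eq_mk_of_sub_mem (sub_mem_coboundaries (e := inA A M B 1) (f := inB A M B 1) ?_ ?_
    inA_one_add_inB_one inB_one_mul_inA_one hX φ.2 fun v => ?_)).symm
  · exact (inA A M B).mul_one 1
  · exact (inB A M B).mul_one 1
  -- The compressions `e t e` and `f t f` are the embedded diagonal entries, so both descriptions of
  -- the block diagonal cochain agree definitionally.
  · simp only [inA_one_mul_mul, inB_one_mul_mul]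
    rfl

end TriangularAlgebra

end

/-- Isomorphism here means a linear homeomorphism for the quotient seminorms on cohomology. -/
theorem theorem3p1 {A B M X : Type*}
    [NormedRing A] [NormedAlgebra ℂ A] [CompleteSpace A]
    [NormedRing B] [NormedAlgebra ℂ B] [CompleteSpace B]
    [NormedAddCommGroup M] [NormedSpace ℂ M] [CompleteSpace M]
    [Module A M] [IsScalarTower ℂ A M] [IsBoundedSMul A M]
    [Module Bᵐᵒᵖ M] [IsScalarTower ℂ Bᵐᵒᵖ M] [IsBoundedSMul Bᵐᵒᵖ M]
    [SMulCommClass A Bᵐᵒᵖ M]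
    [NormedAddCommGroup X] [NormedSpace ℂ X] [CompleteSpace X]
    [Module (TriangularAlgebra A M B) X] [IsScalarTower ℂ (TriangularAlgebra A M B) X]
    [ContinuousSMul (TriangularAlgebra A M B) X]
    [Module (TriangularAlgebra A M B)ᵐᵒᵖ X] [IsScalarTower ℂ (TriangularAlgebra A M B)ᵐᵒᵖ X]
    [ContinuousSMul (TriangularAlgebra A M B)ᵐᵒᵖ X]
    [SMulCommClass (TriangularAlgebra A M B) (TriangularAlgebra A M B)ᵐᵒᵖ X]
    (hX : peirceSpace X (TriangularAlgebra.inA A M B 1) (TriangularAlgebra.inB A M B 1) = ⊥)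
    (n : ℕ) :
    Nonempty (Hochschild.Cohomology (TriangularAlgebra A M B) X n ≃L[ℂ]
      Hochschild.Cohomology A (Corner (TriangularAlgebra.inA A M B) X) n ×
        Hochschild.Cohomology B (Corner (TriangularAlgebra.inB A M B) X) n) := by
  have hX' : ∀ x : X, TriangularAlgebra.inA A M B 1 • op (TriangularAlgebra.inB A M B 1) • x = 0 :=
    fun x => (Submodule.mem_bot ℂ).1 (hX ▸ ⟨x, rfl⟩)
  exact ⟨ContinuousLinearEquiv.equivOfInverse
    (TriangularAlgebra.restrictCohomology A M B X n) (TriangularAlgebra.inflateCohomology hX' n)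
    (TriangularAlgebra.inflateCohomology_restrictCohomology hX' n)
    (TriangularAlgebra.restrictCohomology_inflateCohomology hX' n)⟩
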